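/- A pushdown automaton (PDA) over a finite alphabet $\Sigma$ has a finite set $Q$ of states, a finite stack alphabet $\Gamma\ni\bot$, an initial state $q_0$, a set $F\subseteq Q$ of final states, and finitely many rules of the form $pX\xrightarrow{a}q\gamma$ with $X\in\Gamma\setminus\{\bot\}$, $\gamma\in(\Gamma\setminus\{\bot\})^*$, or of the form $p\bot\xrightarrow{a}q\gamma\bot$ with $\gamma\in(\Gamma\setminus\{\bot\})^*$, where $a\in\Sigma\cup\{\varepsilon\}$. Such a rule gives the $a$-labelled steps from $pX\beta$ to $q\gamma\beta$, respectively from $p\bot$ to $q\gamma\bot$. The automaton accepts a word $w\in\Sigma^*$ if some path starting at $q_0\bot$, whose sequence of labels with the $\varepsilon$'s deleted is $w$, ends in a configuration with a final state. A PDA is *realtime* if no rule has label $\varepsilon$. It is *deterministic* if for all $p,X,a$ (with $a\in\Sigma\cup\{\varepsilon\}$) there is at most one rule with left side $pX$ and label $a$, and whenever there is an $\varepsilon$-rule for $pX$ there is no rule for $pX$ labelled with a letter. It is *normalized* if every $w\in\Sigma^*$ labels (after deletion of $\varepsilon$'s) some path from $q_0\bot$, no state has both $\varepsilon$-rules and rules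 labelled with letters, and every rule has one of the forms $pX\xrightarrow{a}q$ (with $X\ne\bot$), $pX\xrightarrow{a}qX$, $pX\xrightarrow{a}qYX$ (with $Y\neq\bot$). It is *height-deterministic* if it is normalized and for each $w\in(\Sigma\cup\{\varepsilon\})^*$ all paths from $q_0\bot$ with label sequence exactly $w$ end with the same stack height. DPDA, RDPDA and HRDPDA denote the families of languages recognized by deterministic, by realtime deterministic, and by height-deterministic realtime deterministic PDAs, respectively. **Theorem.** The family HRDPDA is not closed under reversal. More precisely, the language $$L=\{1a^nb^n\mid n\ge 0\}\cup\{2a^nb^{2n}\mid n\ge 0\}$$ over $\Sigma=\{1,2,a,b\}$ is in RDPDA and in HRDPDA, but its reversal $L^R$ is not in DPDA (hence not in RDPDA, and not in HRDPDA). -/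

import Mathlib

/-- A pushdown automaton over the input alphabet `α`, with finite sets of states, stack symbols
and rules. `Γ` is the type of the stack symbols *other than* the bottom symbol `⊥`; the full stack
alphabet is `Option Γ`, where `none` stands for `⊥`. An input label is an element of `Option α`,
where `none` stands for `ε`.

A rule `(p, X, a, q, γ)` is read as follows, where `γ` is a string without `⊥`, top symbol first:
* if `X` is an ordinary symbol, it is `pX --a--> qγ` (the top symbol `X` is replaced by `γ`);
* if `X = ⊥`, it is `p⊥ --a--> qγ⊥` (the bottom symbol is never removed, and never pushed). -/
structure PDA (α : Type) where
  Q : Type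
  Γ : Type
  finite_Q : Finite Q
  finite_Γ : Finite Γ
  δ : Set (Q × Option Γ × Option α × Q × List Γ)
  finite_δ : δ.Finite
  q₀ : Q
  F : Set Q

namespace PDA

variable {α : Type} (A : PDA α)

/-- The pair `(q, γ)` is the configuration `qγ⊥`. -/
abbrev Config : Type := A.Q × List A.Γ

/-- The initial configuration `q₀⊥`. -/
def init : A.Config := (A.q₀, [])

/-- The edges of the labelled transition system generated by the automaton. -/
inductive Step : A.Config → Option α → A.Config → Prop
  | bottom {p q : A.Q} {a : Option α} {γ : List A.Γ} :
      (p, none, a, q, γ) ∈ A.δ → Step (p, []) a (q, γ)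
  | top {p q : A.Q} {X : A.Γ} {a : Option α} {γ : List A.Γ} (β : List A.Γ) :
      (p, some X, a, q, γ) ∈ A.δ → Step (p, X :: β) a (q, γ ++ β)

/-- `A.Path c w d`: there is a path from `c` to `d` whose sequence of labels, occurrences of `ε`
included, is exactly `w`. -/
inductive Path : A.Config → List (Option α) → A.Config → Prop
  | nil (c : A.Config) : Path c [] c
  | cons {c d e : A.Config} {a : Option α} {w : List (Option α)} :
      A.Step c a d → Path d w e → Path c (a :: w) e

/-- `A.Reaches c w d`: there is a path from `c` to `d` whose sequence of labels becomes `w` when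
the occurrences of `ε` are deleted. -/
def Reaches (c : A.Config) (w : List α) (d : A.Config) : Prop :=
  ∃ w' : List (Option α), A.Path c w' d ∧ w'.reduceOption = w

/-- The recognized language (acceptance by final state). -/
def language : Language α :=
  {w | ∃ d : A.Config, A.Reaches A.init w d ∧ d.1 ∈ A.F}

/-- No rule reads `ε`. -/
def Realtime : Prop :=
  ∀ p X a q γ, (p, X, a, q, γ) ∈ A.δ → a ≠ none

/-- At most one rule for each state, top symbol and label (a letter or `ε`), and an `ε`-rule
excludes rules that read a letter. -/
def Deterministic : Prop :=
  (∀ p X a q γ q' γ', (p, X, a, q, γ) ∈ A.δ → (p, X, a, q', γ') ∈ A.δ → q = q' ∧ γ = γ') ∧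
  ∀ p X a q γ q' γ', (p, X, none, q, γ) ∈ A.δ → (p, X, a, q', γ') ∈ A.δ → a = none

/-- Every input word can be read. -/
def Complete : Prop :=
  ∀ w : List α, ∃ d : A.Config, A.Reaches A.init w d

/-- Completeness; no state has both `ε`-rules and rules reading a letter; every rule is of one of
the forms `pX --a--> q` (only for `X ≠ ⊥`), `pX --a--> qX` and `pX --a--> qYX`. -/
structure Normalized : Prop where
  complete : A.Complete
  separated : ∀ p, (∀ X a q γ, (p, X, a, q, γ) ∈ A.δ → a ≠ none) ∨
    (∀ X a q γ, (p, X, a, q, γ) ∈ A.δ → a = none)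
  rule_bottom : ∀ p a q γ, (p, none, a, q, γ) ∈ A.δ → γ = [] ∨ ∃ Y, γ = [Y]
  rule_top : ∀ p X a q γ, (p, some X, a, q, γ) ∈ A.δ →
    γ = [] ∨ γ = [X] ∨ ∃ Y, γ = [Y, X]

/-- The set of stack heights (not counting `⊥`) reached after reading a word over `Σ ∪ {ε}`. -/
def heights (w : List (Option α)) : Set ℕ :=
  {n | ∃ d : A.Config, A.Path A.init w d ∧ d.2.length = n}

/-- Normalized, and for every word over `Σ ∪ {ε}` at most one stack height is reached. -/
def HeightDeterministic : Prop :=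
  A.Normalized ∧ ∀ w : List (Option α), (A.heights w).Subsingleton

end PDA

/-- `L` is recognized by a deterministic pushdown automaton. -/
def IsDPDALanguage {α : Type} (L : Language α) : Prop :=
  ∃ A : PDA α, A.Deterministic ∧ A.language = L

/-- `L` is recognized by a realtime deterministic pushdown automaton. -/
def IsRDPDALanguage {α : Type} (L : Language α) : Prop :=
  ∃ A : PDA α, A.Realtime ∧ A.Deterministic ∧ A.language = L

/-- `L` is recognized by a height-deterministic realtime deterministic pushdown automaton. -/
def IsHRDPDALanguage {α : Type} (L : Language α) : Prop :=
  ∃ A : PDA α, A.HeightDeterministic ∧ A.Realtime ∧ A.Deterministic ∧ A.language = L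

/-- The four-letter alphabet `{1, 2, a, b}`. -/
inductive Letter : Type
  | one
  | two
  | a
  | b

/-- The language `{1 aⁿ bⁿ ∣ n ≥ 0} ∪ {2 aⁿ b²ⁿ ∣ n ≥ 0}`. -/
def witnessLanguage : Language Letter :=
  {w | ∃ n : ℕ,
    w = Letter.one :: (List.replicate n Letter.a ++ List.replicate n Letter.b) ∨
    w = Letter.two :: (List.replicate n Letter.a ++ List.replicate (2 * n) Letter.b)}

/-! Reading `witnessLanguage` forwards is easy: the first letter announces the ratio, and one stack
symbol per `a` is then matched by one or two letters `b`. Acceptance is by state, so the first `a`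
pushes a marker whose removal reveals that the match is complete. The transition function is total
and each rule pops, keeps or pushes one symbol, so every word leads to exactly one configuration and
height-determinism is immediate.

In the reversal the ratio is announced last: `bᴺaᵐ1` belongs to it iff `N = m`, and `bᴺaᵐ2` iff `N =
2m`. Suppose a deterministic automaton recognizes it. Configurations on powers of `b` are pairwise
distinct, so the stack must grow; by pigeonhole it has the form `ηδʲβ` along an arithmetic
progression of exponents (`exists_linear_growth`). Now let it read letters `a`
(`not_accepts_two_ratios`).

If every `ηδⁱ` can be removed by letters `a` alone, two of these removals end in the same state.
Hence adding a fixed number `2kd` of letters `b` is compensated by a fixed number `e` of letters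
`a`, whatever the last letter is. The first ratio forces `e = 2kd` and the second `e = kd`, which is
absurd.

If some `ηδⁱ` cannot be so removed, what lies below it is not inspected before the last letter, and
is then known only through a state. Finitely many states cannot tell all the exponents apart. -/

/-! ### Runs in labelled transition systems -/

/-- `LabelledRun S c w d`: the labelled transition system `S` has a path from `c` to `d` whose
labels spell `w` once the occurrences of `ε` (that is, `none`) are deleted. -/
inductive LabelledRun {C α : Type} (S : C → Option α → C → Prop) : C → List α → C → Prop
  | nil (c : C) : LabelledRun S c [] c
  | eps {c d e : C} {w : List α} :
      S c none d → LabelledRun S d w e → LabelledRun S c w e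
  | letter {c d e : C} {a : α} {w : List α} :
      S c (some a) d → LabelledRun S d w e → LabelledRun S c (a :: w) e

/-- Distinct edges leaving a vertex carry distinct labels, and an `ε`-edge excludes all others. -/
def DeterministicSteps {C α : Type} (S : C → Option α → C → Prop) : Prop :=
  ∀ c a d b e, S c a d → S c b e → (a = b → d = e) ∧ (a = none → b = none)

namespace LabelledRun

variable {C α : Type} {S T : C → Option α → C → Prop}

theorem trans {c d e : C} {u v : List α} (h : LabelledRun S c u d) (h' : LabelledRun S d v e) :
    LabelledRun S c (u ++ v) e := by
  induction h with
  | nil => exact h'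
  | eps s _ ih => exact .eps s (ih h')
  | letter s _ ih => exact .letter s (ih h')

theorem mono (hST : ∀ c a d, S c a d → T c a d) {c d : C} {w : List α}
    (h : LabelledRun S c w d) : LabelledRun T c w d := by
  induction h with
  | nil => exact .nil _
  | eps s _ ih => exact .eps (hST _ _ _ s) ih
  | letter s _ ih => exact .letter (hST _ _ _ s) ih

theorem exists_of_append {c e : C} {u v w : List α} (h : LabelledRun S c w e) (hw : w = u ++ v) :
    ∃ d, LabelledRun S c u d ∧ LabelledRun S d v e := by
  induction h generalizing u with
  | nil c =>
    obtain ⟨rfl, rfl⟩ := List.append_eq_nil_iff.1 hw.symm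
    exact ⟨c, .nil c, .nil c⟩
  | eps s _ ih =>
    obtain ⟨d, h₁, h₂⟩ := ih hw
    exact ⟨d, .eps s h₁, h₂⟩
  | @letter c d e a w s r ih =>
    cases u with
    | nil => exact ⟨c, .nil c, by rw [List.nil_append] at hw; exact hw ▸ .letter s r⟩
    | cons x u =>
      rw [List.cons_append, List.cons.injEq] at hw
      obtain ⟨rfl, hw⟩ := hw
      obtain ⟨d, h₁, h₂⟩ := ih hw
      exact ⟨d, .letter s h₁, h₂⟩

/-- In a deterministic system, of two runs on words one of which is a prefix of the other, one
extends the other. -/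
theorem continue_or (hS : DeterministicSteps S) {c d e : C} {u v w : List α}
    (h : LabelledRun S c u d) (h' : LabelledRun S c w e) (hw : w = u ++ v) :
    LabelledRun S d v e ∨ (v = [] ∧ LabelledRun S e [] d) := by
  induction h generalizing w with
  | nil => left; rw [List.nil_append] at hw; exact hw ▸ h'
  | @eps c c' d u s r ih =>
    cases h' with
    | nil =>
      obtain ⟨rfl, rfl⟩ := List.append_eq_nil_iff.1 hw.symm
      exact Or.inr ⟨rfl, .eps s r⟩
    | eps s' r' =>
      obtain rfl := (hS _ _ _ _ _ s s').1 rfl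
      exact ih r' hw
    | letter s' r' => simpa using (hS _ _ _ _ _ s s').2 rfl
  | @letter c c' d x u s r ih =>
    cases h' with
    | nil => simp at hw
    | eps s' r' => simpa using (hS _ _ _ _ _ s' s).2 rfl
    | letter s' r' =>
      rw [List.cons_append, List.cons.injEq] at hw
      obtain ⟨rfl, hw⟩ := hw
      obtain rfl := (hS _ _ _ _ _ s s').1 rfl
      exact ih r' hw

/-- Nonemptiness of `v` matters: runs on the same word may differ in how many trailing `ε`-steps
they take, and only the next letter forces these to have been made. -/
theorem continue_of_ne_nil (hS : DeterministicSteps S) {c d e : C} {u v : List α}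
    (h : LabelledRun S c u d) (h' : LabelledRun S c (u ++ v) e) (hv : v ≠ []) :
    LabelledRun S d v e :=
  (h.continue_or hS h' rfl).resolve_right fun h => hv h.1

end LabelledRun

/-! ### Pushdown runs and the untouched part of the stack -/

namespace PDA

variable {α : Type} {A : PDA α}

theorem reaches_iff {c d : A.Config} {w : List α} :
    A.Reaches c w d ↔ LabelledRun A.Step c w d := by
  constructor
  · rintro ⟨w', h, rfl⟩
    induction h with
    | nil => exact .nil _
    | @cons c d e a w s _ ih =>
      cases a with
      | none => rw [List.reduceOption_cons_of_none]; exact .eps s ih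
      | some a => rw [List.reduceOption_cons_of_some]; exact .letter s ih
  · intro h
    induction h with
    | nil => exact ⟨[], .nil _, rfl⟩
    | eps s _ ih =>
      obtain ⟨w', p, rfl⟩ := ih
      exact ⟨none :: w', .cons s p, List.reduceOption_cons_of_none _⟩
    | @letter _ _ _ a _ s _ ih =>
      obtain ⟨w', p, rfl⟩ := ih
      exact ⟨some a :: w', .cons s p, List.reduceOption_cons_of_some _ _⟩

theorem Deterministic.steps (hA : A.Deterministic) : DeterministicSteps A.Step := by
  intro c a d b e h h'
  cases h with
  | bottom h =>
    cases h' with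
    | bottom h' =>
      refine ⟨?_, ?_⟩
      · rintro rfl
        obtain ⟨rfl, rfl⟩ := hA.1 _ _ _ _ _ _ _ h h'
        rfl
      · rintro rfl
        exact hA.2 _ _ _ _ _ _ _ h h'
  | top β h =>
    cases h' with
    | top _ h' =>
      refine ⟨?_, ?_⟩
      · rintro rfl
        obtain ⟨rfl, rfl⟩ := hA.1 _ _ _ _ _ _ _ h h'
        rfl
      · rintro rfl
        exact hA.2 _ _ _ _ _ _ _ h h'

variable (A) in
/-- The steps that replace an ordinary stack symbol; these are insensitive to what lies below. -/
inductive TopStep : A.Config → Option α → A.Config → Prop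
  | intro {p q : A.Q} {X : A.Γ} {a : Option α} {γ : List A.Γ} (β : List A.Γ) :
      (p, some X, a, q, γ) ∈ A.δ → TopStep (p, X :: β) a (q, γ ++ β)

theorem TopStep.step {c : A.Config} {a : Option α} {d : A.Config} (h : A.TopStep c a d) :
    A.Step c a d := by
  cases h with
  | intro β h => exact .top β h

theorem Deterministic.topSteps (hA : A.Deterministic) : DeterministicSteps A.TopStep :=
  fun _ _ _ _ _ h h' => hA.steps _ _ _ _ _ h.step h'.step

theorem topRun_append {c d : A.Config} {w : List α} (h : LabelledRun A.TopStep c w d)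
    (β : List A.Γ) : LabelledRun A.TopStep (c.1, c.2 ++ β) w (d.1, d.2 ++ β) := by
  have key : ∀ {c d : A.Config} {a}, A.TopStep c a d →
      A.TopStep (c.1, c.2 ++ β) a (d.1, d.2 ++ β) := by
    rintro _ _ a ⟨β', h⟩
    simpa using TopStep.intro (β' ++ β) h
  induction h with
  | nil => exact .nil _
  | eps s _ ih => exact .eps (key s) ih
  | letter s _ ih => exact .letter (key s) ih

theorem run_append {c d : A.Config} {w : List α} (h : LabelledRun A.TopStep c w d)
    (β : List A.Γ) : LabelledRun A.Step (c.1, c.2 ++ β) w (d.1, d.2 ++ β) :=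
  (topRun_append h β).mono fun _ _ _ => TopStep.step

theorem topRun_nil {q : A.Q} {w : List α} {d : A.Config}
    (h : LabelledRun A.TopStep (q, []) w d) : w = [] ∧ d = (q, []) := by
  cases h with
  | nil => exact ⟨rfl, rfl⟩
  | eps s _ => cases s
  | letter s _ => cases s

/-- A run from a stack `γβ` either stays above `β`, or removes `γ` and goes on from `β`. -/
theorem run_split {c d : A.Config} {w : List α} (h : LabelledRun A.Step c w d) {q : A.Q}
    {γ β : List A.Γ} (hc : c = (q, γ ++ β)) :
    (∃ γ', d.2 = γ' ++ β ∧ LabelledRun A.TopStep (q, γ) w (d.1, γ')) ∨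
    ∃ s u v, w = u ++ v ∧ LabelledRun A.TopStep (q, γ) u (s, []) ∧
      LabelledRun A.Step (s, β) v d := by
  have key : ∀ {q : A.Q} {Y : A.Γ} {γ : List A.Γ} {a : Option α} {d : A.Config},
      A.Step (q, (Y :: γ) ++ β) a d → ∃ p γ', d = (p, γ' ++ β) ∧
        A.TopStep (q, Y :: γ) a (p, γ') := by
    intro q Y γ a d s
    rw [List.cons_append] at s
    cases s with
    | @top _ p _ _ γ₁ _ h => exact ⟨p, γ₁ ++ γ, by simp, .intro γ h⟩
  induction h generalizing q γ with
  | nil =>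
    subst hc
    exact Or.inl ⟨γ, rfl, .nil _⟩
  | eps s r ih =>
    subst hc
    cases γ with
    | nil => exact Or.inr ⟨q, [], _, rfl, .nil _, .eps s r⟩
    | cons Y γ =>
      obtain ⟨p, γ₁, hd, s'⟩ := key s
      rcases ih hd with ⟨γ', h₁, h₂⟩ | ⟨t, u, v, rfl, h₁, h₂⟩
      · exact Or.inl ⟨γ', h₁, .eps s' h₂⟩
      · exact Or.inr ⟨t, u, v, rfl, .eps s' h₁, h₂⟩
  | @letter _ _ _ x _ s r ih =>
    subst hc
    cases γ with
    | nil => exact Or.inr ⟨q, [], _, rfl, .nil _, .letter s r⟩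
    | cons Y γ =>
      obtain ⟨p, γ₁, hd, s'⟩ := key s
      rcases ih hd with ⟨γ', h₁, h₂⟩ | ⟨t, u, v, rfl, h₁, h₂⟩
      · exact Or.inl ⟨γ', h₁, .letter s' h₂⟩
      · exact Or.inr ⟨t, x :: u, v, rfl, .letter s' h₁, h₂⟩

variable (A) in
/-- Some run on `w` from the configuration `c` ends in a final state. -/
def Accepts (c : A.Config) (w : List α) : Prop :=
  ∃ d : A.Config, LabelledRun A.Step c w d ∧ d.1 ∈ A.F

theorem mem_language {w : List α} : w ∈ A.language ↔ A.Accepts A.init w := by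
  change (∃ d, A.Reaches A.init w d ∧ d.1 ∈ A.F) ↔ _
  simp only [reaches_iff, Accepts]

theorem Accepts.of_run {c d : A.Config} {u v : List α} (h : LabelledRun A.Step c u d)
    (h' : A.Accepts d v) : A.Accepts c (u ++ v) := by
  obtain ⟨e, r, he⟩ := h'
  exact ⟨e, h.trans r, he⟩

theorem Accepts.continue (hA : A.Deterministic) {c d : A.Config} {u v : List α}
    (h' : A.Accepts c (u ++ v)) (h : LabelledRun A.Step c u d) (hv : v ≠ []) :
    A.Accepts d v := by
  obtain ⟨e, r, he⟩ := h'
  exact ⟨e, h.continue_of_ne_nil hA.steps r hv, he⟩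

end PDA

/-! ### Stack growth and the impossibility argument -/

open List (replicate)

/-- The `n`-th power of a word. -/
abbrev wordPow {β : Type} (l : List β) (n : ℕ) : List β := (replicate n l).flatten

theorem wordPow_add {β : Type} (l : List β) (m n : ℕ) :
    wordPow l (m + n) = wordPow l m ++ wordPow l n := by
  rw [wordPow, List.replicate_add, List.flatten_append]

theorem wordPow_succ {β : Type} (l : List β) (n : ℕ) :
    wordPow l (n + 1) = l ++ wordPow l n := by
  rw [wordPow, List.replicate_succ, List.flatten_cons]

namespace PDA

variable {α : Type} {A : PDA α}

/-- If the configurations on the words `xⁿ` of a deterministic automaton tell the number `n`, then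
along a subsequence of even exponents the stack grows by powers of one word. -/
theorem exists_linear_growth (hA : A.Deterministic) (x : α)
    (hrun : ∀ n, ∃ c, LabelledRun A.Step A.init (replicate n x) c)
    (hinj : ∀ n m c, LabelledRun A.Step A.init (replicate n x) c →
      LabelledRun A.Step A.init (replicate m x) c → n = m) :
    ∃ (p : A.Q) (η δ β : List A.Γ) (N k : ℕ), 0 < k ∧ ∀ j,
      LabelledRun A.Step A.init (replicate (2 * (N + k * j)) x) (p, η ++ (wordPow δ j ++ β)) := by
  have := A.finite_Q
  have := A.finite_Γ
  -- By injectivity each state occurs with empty stack for at most one exponent, and there are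
  -- finitely many states.
  obtain ⟨M, hM⟩ : ∃ M, ∀ n s, M ≤ n → ¬ LabelledRun A.Step A.init (replicate n x) (s, []) := by
    have hfin : (⋃ s : A.Q, {n | LabelledRun A.Step A.init (replicate n x) (s, [])}).Finite :=
      Set.finite_iUnion fun s => Set.Subsingleton.finite fun n hn m hm => hinj n m _ hn hm
    obtain ⟨M, hM⟩ := hfin.bddAbove
    refine ⟨M + 1, fun n s hn h => ?_⟩
    have := hM (Set.mem_iUnion.2 ⟨s, h⟩)
    omega
  -- As long as the top symbol can be removed by letters `x`, remove it. This stops at a symbol that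
  -- no power of `x` removes, since otherwise the stack would be empty after at least `M` letters.
  have good : ∀ n, ∃ n' s X σ, n ≤ n' ∧
      LabelledRun A.Step A.init (replicate n' x) (s, X :: σ) ∧
      ∀ m t, ¬ LabelledRun A.TopStep (s, [X]) (replicate m x) (t, []) := by
    have aux : ∀ (γ : List A.Γ) (n : ℕ) (q : A.Q), M ≤ n →
        LabelledRun A.Step A.init (replicate n x) (q, γ) →
        ∃ n' s X σ, n ≤ n' ∧ LabelledRun A.Step A.init (replicate n' x) (s, X :: σ) ∧
          ∀ m t, ¬ LabelledRun A.TopStep (s, [X]) (replicate m x) (t, []) := by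
      intro γ
      induction γ with
      | nil => exact fun n q hn h => (hM n q hn h).elim
      | cons X γ ih =>
        intro n q hn h
        by_cases hX : ∀ m t, ¬ LabelledRun A.TopStep (q, [X]) (replicate m x) (t, [])
        · exact ⟨n, q, X, γ, le_rfl, h, hX⟩
        · push Not at hX
          obtain ⟨m, t, ht⟩ := hX
          have h' := h.trans (run_append ht γ)
          rw [← List.replicate_add] at h'
          obtain ⟨n', s, Y, σ, h₁, h₂⟩ := ih (n + m) t (by omega) h'
          exact ⟨n', s, Y, σ, by omega, h₂⟩
    intro n
    obtain ⟨c, hc⟩ := hrun (M + n)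
    obtain ⟨n', s, X, σ, h₁, h₂⟩ := aux c.2 (M + n) c.1 (by omega) hc
    exact ⟨n', s, X, σ, by omega, h₂⟩
  choose n s X σ hn hr hX using good
  obtain ⟨⟨s₀, X₀⟩, hinf⟩ := Finite.exists_infinite_fiber fun i => (s i, X i)
  rw [Set.infinite_coe_iff] at hinf
  obtain ⟨i, hi⟩ := hinf.nonempty
  -- Taking `j` beyond `n i`, rather than beyond `i`, gives `n i < j ≤ n j`.
  obtain ⟨j, hj, hij⟩ := hinf.exists_gt (n i)
  simp only [Set.mem_preimage, Set.mem_singleton_iff, Prod.mk.injEq] at hi hj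
  have hri := hr i
  have hrj := hr j
  have hXi := hX i
  rw [hi.1, hi.2] at hri hXi
  rw [hj.1, hj.2] at hrj
  obtain ⟨k, hk, hnk⟩ : ∃ k, 0 < k ∧ n j = n i + k :=
    ⟨n j - n i, by have := hn j; omega, by have := hn j; omega⟩
  -- The symbol `X₀` is never removed, so the part `σ i` below it stays untouched from now on.
  have above : ∀ k c, 0 < k → LabelledRun A.Step A.init (replicate (n i + k) x) c →
      ∃ γ, c.2 = γ ++ σ i ∧ LabelledRun A.TopStep (s₀, [X₀]) (replicate k x) (c.1, γ) := by
    intro k c hk h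
    rw [List.replicate_add] at h
    have h' := hri.continue_of_ne_nil hA.steps h (by simp; omega)
    rcases run_split (γ := [X₀]) h' rfl with h' | ⟨t, u, v, huv, h', -⟩
    · exact h'
    · obtain ⟨-, hu, -⟩ := List.append_eq_replicate_iff.1 huv.symm
      rw [hu] at h'
      exact (hXi _ _ h').elim
  rw [hnk] at hrj
  obtain ⟨γ, hγ, hloop⟩ := above k _ hk hrj
  obtain ⟨δ, rfl⟩ : ∃ δ, γ = X₀ :: δ := by
    cases γ with
    | nil => exact (hXi _ _ hloop).elim
    | cons Y δ =>
      simp only [List.cons_append, List.cons.injEq] at hγ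
      exact ⟨δ, by rw [hγ.1]⟩
  -- The loop from `X₀` to `X₀δ` is taken twice per round, so that all exponents have the parity of
  -- `n i`.
  have pump : ∀ j, LabelledRun A.Step A.init (replicate (n i + 2 * (k * j)) x)
      (s₀, X₀ :: (wordPow (δ ++ δ) j ++ σ i)) := by
    intro j
    induction j with
    | zero => simpa [wordPow] using hri
    | succ j ih =>
      have h₁ := ih.trans (run_append hloop _)
      have h₂ := h₁.trans (run_append hloop (δ ++ (wordPow (δ ++ δ) j ++ σ i)))
      rw [← List.replicate_add, ← List.replicate_add] at h₂
      rw [show n i + 2 * (k * (j + 1)) = n i + 2 * (k * j) + k + k by ring, wordPow_succ]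
      simpa using h₂
  rcases Nat.even_or_odd' (n i) with ⟨N, hN | hN⟩
  · refine ⟨s₀, [X₀], δ ++ δ, σ i, N, k, hk, fun j => ?_⟩
    rw [mul_add, ← hN]
    exact pump j
  -- One more letter makes the exponents even; its run only replaces `X₀`, by some `η`.
  · obtain ⟨c, hc⟩ := hrun (n i + 1)
    obtain ⟨η, -, hη⟩ := above 1 c one_pos hc
    refine ⟨c.1, η, δ ++ δ, σ i, N + 1, k, hk, fun j => ?_⟩
    have h := (pump j).trans (run_append hη _)
    rw [← List.replicate_add] at h
    rw [show 2 * (N + 1 + k * j) = n i + 2 * (k * j) + 1 by rw [hN]; ring]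
    exact h

/-- A deterministic automaton cannot compare the exponents of `xᴺyᵐ` both for `N = m` and for
`N = 2m`, the comparison to make being announced by the last letter. -/
theorem not_accepts_two_ratios (hA : A.Deterministic) {x y z₁ z₂ : α}
    (h₁ : ∀ N m, A.Accepts A.init (replicate N x ++ (replicate m y ++ [z₁])) ↔ N = m)
    (h₂ : ∀ N m, A.Accepts A.init (replicate N x ++ (replicate m y ++ [z₂])) ↔ N = 2 * m) :
    False := by
  have := A.finite_Q
  obtain ⟨p, η, δ, β, N, k, hk, hgrow⟩ := exists_linear_growth hA x
    (fun n => by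
      obtain ⟨d, h, -⟩ := (h₁ n n).2 rfl
      obtain ⟨c, h, -⟩ := h.exists_of_append rfl
      exact ⟨c, h⟩)
    (fun n m c hn hm =>
      ((h₁ m n).1 (.of_run hm (((h₁ n n).2 rfl).continue hA hn (by simp)))).symm)
  -- Can every `ηδⁱ` be removed by reading letters `y` only?
  by_cases hpop : ∀ i, ∃ m s, LabelledRun A.TopStep (p, η ++ wordPow δ i) (replicate m y) (s, [])
  · choose m s hpop using hpop
    obtain ⟨r, hinf⟩ := Finite.exists_infinite_fiber s
    rw [Set.infinite_coe_iff] at hinf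
    obtain ⟨i, hi⟩ := hinf.nonempty
    obtain ⟨i', hi', hlt⟩ := hinf.exists_gt i
    simp only [Set.mem_preimage, Set.mem_singleton_iff] at hi hi'
    obtain ⟨d, hd, rfl⟩ : ∃ d, 0 < d ∧ i' = i + d := ⟨i' - i, by omega, by omega⟩
    have hp := hpop i
    have hp' := hpop (i + d)
    rw [hi] at hp
    rw [hi'] at hp'
    -- Were the taller stack emptied by fewer letters, the run removing `ηδⁱ` above `δᵈ` would have
    -- to continue from an already empty stack.
    have hcyc : ∃ e, m (i + d) = m i + e := by
      by_contra hne
      have hlt : m (i + d) < m i := by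
        by_contra hge
        exact hne ⟨m (i + d) - m i, by omega⟩
      have hq := topRun_append hp (wordPow δ d)
      obtain ⟨e, he⟩ := Nat.exists_eq_add_of_lt hlt
      rw [he, add_assoc, List.replicate_add] at hq
      rw [wordPow_add, ← List.append_assoc] at hp'
      have := topRun_nil (hp'.continue_of_ne_nil hA.topSteps hq (by simp))
      simp at this
    obtain ⟨e, he⟩ := hcyc
    have down : ∀ u, LabelledRun A.Step A.init
        (replicate (2 * (N + k * (i + u))) x ++ replicate (m i) y) (r, wordPow δ u ++ β) := by
      intro u
      have h := hgrow (i + u)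
      rw [wordPow_add, List.append_assoc, ← List.append_assoc] at h
      exact h.trans (run_append hp _)
    have down' : ∀ u, LabelledRun A.Step A.init
        (replicate (2 * (N + k * (i + d + u))) x ++ replicate (m i + e) y)
        (r, wordPow δ u ++ β) := by
      intro u
      have h := hgrow (i + d + u)
      rw [wordPow_add, List.append_assoc, ← List.append_assoc] at h
      rw [← he]
      exact h.trans (run_append hp' _)
    -- `down` and `down'` reach the same configuration, so every continuation accepted after the one
    -- is accepted after the other.
    have transfer : ∀ u l z, A.Accepts A.init (replicate (2 * (N + k * (i + u))) x ++
          (replicate (m i + l) y ++ [z])) →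
        A.Accepts A.init (replicate (2 * (N + k * (i + d + u))) x ++
          (replicate (m i + e + l) y ++ [z])) := by
      intro u l z h
      rw [List.replicate_add, List.append_assoc, ← List.append_assoc] at h
      have h' := Accepts.of_run (down' u) (h.continue hA (down u) (by simp))
      rw [List.replicate_add (m i + e), List.append_assoc, ← List.append_assoc]
      exact h'
    -- The choice `u = m i` makes the exponent large enough for both ratios to require at least `m
    -- i` letters `y`.
    obtain ⟨l, hl⟩ : ∃ l, N + k * (i + m i) = m i + l :=
      Nat.exists_eq_add_of_le (by nlinarith)
    -- Here `e₁` amounts to `e = 2kd`, and `e₂` below to `e = kd`.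
    have e₁ := (h₁ _ _).1 (transfer (m i) (m i + l + l) z₁ ((h₁ _ _).2 (by omega)))
    have e₂ := (h₂ _ _).1 (transfer (m i) l z₂ ((h₂ _ _).2 (by omega)))
    have hkd : 0 < k * d := Nat.mul_pos hk hd
    have hexp : k * (i + d + m i) = k * (i + m i) + k * d := by ring
    omega
  · push Not at hpop
    obtain ⟨i, hpop⟩ := hpop
    -- The part `ηδⁱ` is emptied exactly on the whole remaining word, including `z₁`; what follows
    -- are `ε`-steps depending only on the state `s` and on `δˡβ`.
    have hsplit : ∀ l, ∃ s, LabelledRun A.TopStep (p, η ++ wordPow δ i)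
          (replicate (2 * (N + k * (i + l))) y ++ [z₁]) (s, []) ∧
        A.Accepts (s, wordPow δ l ++ β) [] := by
      intro l
      have hacc := ((h₁ _ _).2 rfl).continue hA (hgrow (i + l)) (by simp)
      rw [wordPow_add, List.append_assoc, ← List.append_assoc] at hacc
      obtain ⟨d, hd, hdF⟩ := hacc
      rcases run_split hd rfl with ⟨γ, -, hγ⟩ | ⟨s, u, v, huv, hs, hv⟩
      -- A run that never uncovers `δˡβ` would accept equally well above `δˡ⁺¹β`, hence after more
      -- letters `x`.
      · exfalso
        have h := hgrow (i + (l + 1))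
        rw [wordPow_add, List.append_assoc, ← List.append_assoc] at h
        have := (h₁ _ _).1 (.of_run h ⟨_, run_append hγ _, hdF⟩)
        nlinarith
      · rcases List.eq_nil_or_concat v with rfl | ⟨v, z, rfl⟩
        · rw [List.append_nil] at huv
          exact ⟨s, huv ▸ hs, d, hv, hdF⟩
        · rw [List.concat_eq_append, ← List.append_assoc] at huv
          obtain ⟨hu, -⟩ := List.append_inj' huv rfl
          obtain ⟨-, hu, -⟩ := List.append_eq_replicate_iff.1 hu.symm
          rw [hu] at hs
          exact (hpop _ _ hs).elim
    choose s hs hacc using hsplit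
    -- For `l ≠ l'` with the same state, the `x`-part for `l` can be combined with the `y`-part for
    -- `l'`, giving an accepted word with unequal exponents.
    obtain ⟨l, l', hne, hll⟩ := Finite.exists_ne_map_eq_of_infinite s
    have h := hgrow (i + l)
    rw [wordPow_add, List.append_assoc, ← List.append_assoc] at h
    have hs' := hs l'
    rw [← hll] at hs'
    have h' := Accepts.of_run h (Accepts.of_run (run_append hs' _) (hacc l))
    rw [List.append_nil] at h'
    have := (h₁ _ _).1 h'
    have : k * (i + l) = k * (i + l') := by omega
    have := Nat.eq_of_mul_eq_mul_left hk this
    omega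

end PDA

/-! ### Automata given by a total transition function -/

/-- The realtime deterministic automaton whose rules are the graph of a total function. -/
def PDA.ofFun {α Q Γ : Type} [Finite α] [Finite Q] [Finite Γ]
    (f : Q → Option Γ → α → Q × List Γ) (q₀ : Q) (F : Set Q) : PDA α where
  Q := Q
  Γ := Γ
  finite_Q := inferInstance
  finite_Γ := inferInstance
  δ := Set.range fun t : Q × Option Γ × α => (t.1, t.2.1, some t.2.2, f t.1 t.2.1 t.2.2)
  finite_δ := Set.finite_range _
  q₀ := q₀
  F := F

namespace PDA

section ofFun

variable {α Q Γ : Type} [Finite α] [Finite Q] [Finite Γ]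
  {f : Q → Option Γ → α → Q × List Γ} {q₀ : Q} {F : Set Q}

theorem mem_ofFun {p q : Q} {X : Option Γ} {a : Option α} {γ : List Γ} :
    (p, X, a, q, γ) ∈ (ofFun f q₀ F).δ ↔
      ∃ x, a = some x ∧ q = (f p X x).1 ∧ γ = (f p X x).2 := by
  constructor
  · rintro ⟨⟨p', X', x⟩, h⟩
    simp only [Prod.mk.injEq] at h
    obtain ⟨rfl, rfl, rfl, h⟩ := h
    exact ⟨x, rfl, congrArg Prod.fst h.symm, congrArg Prod.snd h.symm⟩
  · rintro ⟨x, rfl, rfl, rfl⟩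
    exact ⟨(p, X, x), rfl⟩

theorem ofFun_realtime : (ofFun f q₀ F).Realtime := by
  rintro p X a q γ h rfl
  obtain ⟨x, hx, -⟩ := mem_ofFun.1 h
  cases hx

theorem ofFun_deterministic : (ofFun f q₀ F).Deterministic := by
  refine ⟨?_, fun p X a q γ _ _ h _ => (ofFun_realtime _ _ _ _ _ h rfl).elim⟩
  intro p X a q γ q' γ' h h'
  obtain ⟨x, rfl, rfl, rfl⟩ := mem_ofFun.1 h
  obtain ⟨x', hxx, rfl, rfl⟩ := mem_ofFun.1 h'
  cases hxx
  exact ⟨rfl, rfl⟩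

/-- The configuration that `PDA.ofFun f` moves to when reading a letter. -/
def moveFun (f : Q → Option Γ → α → Q × List Γ) (c : Q × List Γ) (x : α) : Q × List Γ :=
  ((f c.1 c.2.head? x).1, (f c.1 c.2.head? x).2 ++ c.2.tail)

theorem ofFun_step_iff {c d : (ofFun f q₀ F).Config} {a : Option α} :
    (ofFun f q₀ F).Step c a d ↔ ∃ x, a = some x ∧ d = moveFun f c x := by
  constructor
  · rintro (h | ⟨β, h⟩)
    · obtain ⟨x, rfl, rfl, rfl⟩ := mem_ofFun.1 h
      exact ⟨x, rfl, Prod.ext rfl (List.append_nil _).symm⟩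
    · obtain ⟨x, rfl, rfl, rfl⟩ := mem_ofFun.1 h
      exact ⟨x, rfl, rfl⟩
  · rintro ⟨x, rfl, rfl⟩
    obtain ⟨p, γ⟩ := c
    cases γ with
    | nil =>
      have := Step.bottom (A := ofFun f q₀ F) (mem_ofFun.2 ⟨x, rfl, rfl, rfl⟩ : (p, none, some x,
        (f p none x).1, (f p none x).2) ∈ (ofFun f q₀ F).δ)
      rwa [← List.append_nil (f p none x).2] at this
    | cons X γ =>
      exact Step.top (A := ofFun f q₀ F) γ (mem_ofFun.2 ⟨x, rfl, rfl, rfl⟩ : (p, some X, some x,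
        (f p (some X) x).1, (f p (some X) x).2) ∈ (ofFun f q₀ F).δ)

theorem ofFun_run_iff {c d : Q × List Γ} {w : List α} :
    LabelledRun (ofFun f q₀ F).Step c w d ↔ d = w.foldl (moveFun f) c := by
  constructor
  · intro h
    induction h with
    | nil => rfl
    | eps s _ _ => obtain ⟨_, hx, _⟩ := ofFun_step_iff.1 s; cases hx
    | letter s _ ih =>
      obtain ⟨_, hx, rfl⟩ := ofFun_step_iff.1 s
      cases hx
      exact ih
  · rintro rfl
    induction w generalizing c with
    | nil => exact .nil _
    | cons x w ih => exact .letter (ofFun_step_iff.2 ⟨x, rfl, rfl⟩) ih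

theorem mem_ofFun_language {w : List α} :
    w ∈ (ofFun f q₀ F).language ↔ (w.foldl (moveFun f) (q₀, [])).1 ∈ F := by
  rw [mem_language]
  constructor
  · rintro ⟨d, h, hd⟩
    rw [ofFun_run_iff.1 h] at hd
    exact hd
  · exact fun h => ⟨_, ofFun_run_iff.2 rfl, h⟩

/-- A total function leaves exactly one run per word, so only the shape of the rules has to be
checked. -/
theorem ofFun_heightDeterministic
    (hbot : ∀ p x, (f p none x).2 = [] ∨ ∃ Y, (f p none x).2 = [Y])
    (htop : ∀ p X x, (f p (some X) x).2 = [] ∨ (f p (some X) x).2 = [X] ∨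
      ∃ Y, (f p (some X) x).2 = [Y, X]) :
    (ofFun f q₀ F).HeightDeterministic := by
  refine ⟨⟨fun w => ⟨_, reaches_iff.2 (ofFun_run_iff.2 rfl)⟩,
    fun p => Or.inl fun X a q γ => ofFun_realtime p X a q γ, ?_, ?_⟩, ?_⟩
  · intro p a q γ h
    obtain ⟨x, rfl, rfl, rfl⟩ := mem_ofFun.1 h
    exact hbot p x
  · intro p X a q γ h
    obtain ⟨x, rfl, rfl, rfl⟩ := mem_ofFun.1 h
    exact htop p X x
  · rintro w _ ⟨d, hd, rfl⟩ _ ⟨e, he, rfl⟩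
    have h₁ := ofFun_run_iff.1 (reaches_iff.1 ⟨w, hd, rfl⟩)
    have h₂ := ofFun_run_iff.1 (reaches_iff.1 ⟨w, he, rfl⟩)
    rw [h₁, h₂]

end ofFun

end PDA

/-! ### The automaton for the witness language -/

instance : Finite Letter :=
  Finite.of_injective (β := Fin 4)
    (fun | .one => 0 | .two => 1 | .a => 2 | .b => 3)
    (by rintro ⟨⟩ ⟨⟩ h <;> first | rfl | simp at h)

namespace WitnessPDA

/-- States of an automaton for `witnessLanguage`. The flag says whether each `a` is to be matched
by two letters `b` (`true`) or by one (`false`). -/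
inductive State : Type
  | start
  | opened (double : Bool)
  | push (double : Bool)
  | pop (double : Bool)
  | half
  | done
  | sink

instance : Finite State :=
  Finite.of_injective (β := Fin 7 × Bool)
    (fun | .start => (0, false) | .opened d => (1, d) | .push d => (2, d) | .pop d => (3, d)
         | .half => (4, false) | .done => (5, false) | .sink => (6, false))
    (by rintro (_ | _) (_ | _) h <;> simp_all)

open State

/-- The effect of a letter `b` that completes the match of the top stack symbol; the symbol `true`
marks the bottom of the stack of matched letters. -/
def popTop (d : Bool) : Option Bool → State × List Bool
  | some true => (done, [])
  | some false => (pop d, [])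
  | none => (sink, [])

/-- The effect of a letter `b`, depending on the number of letters `b` per stack symbol. -/
def readB : Bool → Option Bool → State × List Bool
  | false, X => popTop false X
  | true, X => (half, X.toList)

/-- The transition function of the automaton for `witnessLanguage`. -/
def trans : State → Option Bool → Letter → State × List Bool
  | start, X, .one => (opened false, X.toList)
  | start, X, .two => (opened true, X.toList)
  | opened d, X, .a => (push d, true :: X.toList)
  | push d, X, .a => (push d, false :: X.toList)
  | push d, X, .b => readB d X
  | pop d, X, .b => readB d X
  | half, X, .b => popTop true X
  | _, X, _ => (sink, X.toList)

/-- The final states. -/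
def Final : Set State := {q | (∃ d, q = opened d) ∨ q = done}

/-- The automaton for `witnessLanguage`. -/
def automaton : PDA Letter := PDA.ofFun trans start Final

theorem automaton_heightDeterministic : automaton.HeightDeterministic := by
  apply PDA.ofFun_heightDeterministic
  · rintro (_ | ⟨_ | _⟩ | ⟨_ | _⟩ | ⟨_ | _⟩ | _ | _ | _) (_ | _ | _ | _) <;>
      simp [trans, readB, popTop]
  · rintro (_ | ⟨_ | _⟩ | ⟨_ | _⟩ | ⟨_ | _⟩ | _ | _ | _) (_ | _) (_ | _ | _ | _) <;>
      simp [trans, readB, popTop]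

/-- Acceptance from a configuration, by running the transition function. -/
def Acc (q : State) (γ : List Bool) (w : List Letter) : Prop :=
  (w.foldl (PDA.moveFun trans) (q, γ)).1 ∈ Final

/-- The stack after reading `n + 1` letters `a`. -/
def stack (n : ℕ) : List Bool := replicate n false ++ [true]

theorem acc_nil {q : State} {γ : List Bool} : Acc q γ [] ↔ q ∈ Final := Iff.rfl

theorem acc_cons {q : State} {γ : List Bool} {x : Letter} {w : List Letter} :
    Acc q γ (x :: w) ↔ Acc (trans q γ.head? x).1 ((trans q γ.head? x).2 ++ γ.tail) w := Iff.rfl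

theorem not_acc_sink (γ : List Bool) (w : List Letter) : ¬ Acc sink γ w := by
  induction w generalizing γ with
  | nil => simp [acc_nil, Final]
  | cons x w ih => rw [acc_cons]; exact ih _

theorem acc_done (γ : List Bool) (w : List Letter) : Acc done γ w ↔ w = [] := by
  cases w with
  | nil => simp [acc_nil, Final]
  | cons x w => exact iff_of_false (not_acc_sink _ w) (by simp)

/-- The number of letters `b` that match one letter `a`. -/
def weight : Bool → ℕ
  | false => 1
  | true => 2

theorem acc_pop (d : Bool) (n : ℕ) (w : List Letter) :
    Acc (pop d) (stack n) w ↔ w = replicate (weight d * (n + 1)) .b := by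
  induction n generalizing w with
  | zero =>
    cases d
    · rcases w with _ | ⟨_ | _ | _ | _, w⟩ <;>
        simp [acc_nil, acc_cons, trans, readB, popTop, Final, not_acc_sink, acc_done, stack,
          weight, List.replicate_succ]
    · rcases w with _ | ⟨_ | _ | _ | _, _ | ⟨_ | _ | _ | _, w⟩⟩ <;>
        simp [acc_nil, acc_cons, trans, readB, popTop, Final, not_acc_sink, acc_done, stack,
          weight, List.replicate_succ]
  | succ n ih =>
    cases d
    · rcases w with _ | ⟨_ | _ | _ | _, w⟩ <;>
        simp [acc_nil, acc_cons, trans, readB, popTop, Final, not_acc_sink, stack,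
          weight, List.replicate_succ]
      simpa [stack, weight, List.replicate_succ] using ih w
    · rcases w with _ | ⟨_ | _ | _ | _, _ | ⟨_ | _ | _ | _, w⟩⟩ <;>
        simp [acc_nil, acc_cons, trans, readB, popTop, Final, not_acc_sink, stack,
          weight, List.replicate_succ, mul_add]
      simpa [stack, weight, List.replicate_succ, mul_add] using ih w

theorem acc_push (d : Bool) (n : ℕ) (w : List Letter) :
    Acc (push d) (stack n) w ↔
      ∃ m, w = replicate m .a ++ replicate (weight d * (m + n + 1)) .b := by
  induction w generalizing n with
  | nil =>
    constructor
    · simp [acc_nil, Final]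
    · rintro ⟨m, h⟩
      cases d <;> simp [weight] at h
  | cons x w ih =>
    cases x with
    | a =>
      have h : Acc (push d) (stack n) (.a :: w) ↔ Acc (push d) (stack (n + 1)) w := by
        cases n <;> rfl
      rw [h, ih]
      constructor
      · rintro ⟨m, rfl⟩
        exact ⟨m + 1, by rw [show m + 1 + n + 1 = m + (n + 1) + 1 by ring]; rfl⟩
      · rintro ⟨m, hm⟩
        cases m with
        | zero => cases d <;> simp [weight, List.replicate_succ, mul_add] at hm
        | succ m =>
          refine ⟨m, ?_⟩
          rw [show m + (n + 1) + 1 = m + 1 + n + 1 by ring]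
          simpa [List.replicate_succ] using hm
    | b =>
      have h : Acc (push d) (stack n) (.b :: w) ↔ Acc (pop d) (stack n) (.b :: w) := Iff.rfl
      rw [h, acc_pop]
      constructor
      · exact fun h => ⟨0, by simpa using h⟩
      · rintro ⟨m, hm⟩
        cases m with
        | zero => simpa using hm
        | succ m => simp [List.replicate_succ] at hm
    | one | two =>
      refine ⟨fun h => (not_acc_sink _ w h).elim, ?_⟩
      rintro ⟨m, hm⟩
      cases m <;> cases d <;> simp [weight, List.replicate_succ, mul_add] at hm

theorem acc_opened (d : Bool) (w : List Letter) :
    Acc (opened d) [] w ↔ ∃ n, w = replicate n .a ++ replicate (weight d * n) .b := by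
  cases w with
  | nil => simp [acc_nil, Final]
  | cons x w =>
    cases x with
    | a =>
      have h : Acc (opened d) [] (.a :: w) ↔ Acc (push d) (stack 0) w := Iff.rfl
      rw [h, acc_push]
      constructor
      · rintro ⟨m, rfl⟩
        exact ⟨m + 1, rfl⟩
      · rintro ⟨m, hm⟩
        cases m with
        | zero => simp at hm
        | succ m => exact ⟨m, by simpa [List.replicate_succ] using hm⟩
    | b | one | two =>
      refine ⟨fun h => (not_acc_sink _ w h).elim, ?_⟩
      rintro ⟨m, hm⟩
      cases m <;> simp [List.replicate_succ] at hm

theorem automaton_language : automaton.language = witnessLanguage := by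
  ext w
  change w ∈ (PDA.ofFun trans start Final).language ↔ ∃ n, _
  rw [PDA.mem_ofFun_language]
  change Acc start [] w ↔ _
  cases w with
  | nil => simp [acc_nil, Final]
  | cons x w =>
    cases x with
    | one =>
      have h : Acc start [] (.one :: w) ↔ Acc (opened false) [] w := Iff.rfl
      simp [h, acc_opened, weight]
    | two =>
      have h : Acc start [] (.two :: w) ↔ Acc (opened true) [] w := Iff.rfl
      simp [h, acc_opened, weight]
    | a | b =>
      refine ⟨fun h => (not_acc_sink _ w h).elim, ?_⟩
      rintro ⟨m, hm | hm⟩ <;> simp at hm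

end WitnessPDA

theorem isHRDPDALanguage_witnessLanguage : IsHRDPDALanguage witnessLanguage :=
  ⟨_, WitnessPDA.automaton_heightDeterministic, PDA.ofFun_realtime, PDA.ofFun_deterministic,
    WitnessPDA.automaton_language⟩

/-! ### The reversed language and the conclusion -/

theorem replicate_append_replicate_inj {β : Type} {x y : β} (hxy : x ≠ y) {m n m' n' : ℕ}
    (h : replicate m x ++ replicate n y = replicate m' x ++ replicate n' y) :
    m = m' ∧ n = n' := by
  classical
  have hx := congrArg (List.count x) h
  have hy := congrArg (List.count y) h
  simp [List.count_replicate, hxy, hxy.symm] at hx hy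
  exact ⟨hx, hy⟩

theorem mem_reverse_one_iff (N m : ℕ) :
    replicate N Letter.b ++ (replicate m Letter.a ++ [Letter.one]) ∈ witnessLanguage.reverse ↔
      N = m := by
  rw [Language.mem_reverse]
  change (∃ n, _) ↔ _
  simp only [List.reverse_append, List.reverse_replicate, List.reverse_singleton,
    List.cons_append, List.cons.injEq, true_and, reduceCtorEq, false_and,
    or_false]
  constructor
  · rintro ⟨n, h⟩
    obtain ⟨rfl, rfl⟩ := replicate_append_replicate_inj (by simp) h
    rfl
  · rintro rfl
    exact ⟨N, rfl⟩

theorem mem_reverse_two_iff (N m : ℕ) :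
    replicate N Letter.b ++ (replicate m Letter.a ++ [Letter.two]) ∈ witnessLanguage.reverse ↔
      N = 2 * m := by
  rw [Language.mem_reverse]
  change (∃ n, _) ↔ _
  simp only [List.reverse_append, List.reverse_replicate, List.reverse_singleton,
    List.cons_append, List.cons.injEq, true_and, reduceCtorEq, false_and,
    false_or]
  constructor
  · rintro ⟨n, h⟩
    obtain ⟨rfl, rfl⟩ := replicate_append_replicate_inj (by simp) h
    rfl
  · rintro rfl
    exact ⟨m, rfl⟩

theorem not_isDPDALanguage_reverse : ¬ IsDPDALanguage witnessLanguage.reverse := by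
  rintro ⟨A, hA, hL⟩
  refine A.not_accepts_two_ratios hA (fun N m => ?_) (fun N m => ?_)
    (x := Letter.b) (y := Letter.a) (z₁ := Letter.one) (z₂ := Letter.two)
  · rw [← PDA.mem_language, hL, mem_reverse_one_iff]
  · rw [← PDA.mem_language, hL, mem_reverse_two_iff]

theorem mainTheorem6 :
    (¬ ∀ (α : Type) [Finite α] (L : Language α),
      IsHRDPDALanguage L → IsHRDPDALanguage L.reverse) ∧
    IsRDPDALanguage witnessLanguage ∧
    IsHRDPDALanguage witnessLanguage ∧
    ¬ IsDPDALanguage witnessLanguage.reverse := by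
  refine ⟨fun h => ?_, ?_, isHRDPDALanguage_witnessLanguage, not_isDPDALanguage_reverse⟩
  · obtain ⟨A, -, -, hA, hL⟩ := h Letter _ isHRDPDALanguage_witnessLanguage
    exact not_isDPDALanguage_reverse ⟨A, hA, hL⟩
  · obtain ⟨A, -, hA⟩ := isHRDPDALanguage_witnessLanguage
    exact ⟨A, hA⟩
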